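/- Let $d, q \in \mathbb{N}$ and let $U \subseteq \mathbb{R}^d$ be a Borel measurable set (in particular, any domain), with Lebesgue measure. Let $L^2(U;\mathbb{R}^q)$ be the Hilbert space of square-integrable vector fields on $U$ with inner product $(\mathbf{u},\mathbf{v}) = \int_U \mathbf{u}^{T}\mathbf{v}\,d\mathbf{x}$, and let $L^2(U\times U;\mathbb{R}^{q\times q})$ be the Hilbert space of square-integrable matrix-valued functions on $U \times U$ with inner product $$(\mathbf{A},\mathbf{B}) = \int_U\int_U \sum_{i,j=1}^{q} A_{ij}(\mathbf{x},\mathbf{y})\,B_{ij}(\mathbf{x},\mathbf{y})\,d\mathbf{x}\,d\mathbf{y}.$$ Let $L^2(U;\mathbb{R}^q)\otimes L^2(U;\mathbb{R}^q)$ be the Hilbert tensor product, that is, the completion of the algebraic tensor product over $\mathbb{R}$ for the inner product determined by $(\mathbf{a}\otimes \mathbf{b}, \mathbf{c}\otimes \mathbf{d}) = (\mathbf{a},\mathbf{c})(\mathbf{b},\mathbf{d})$. Then there is an isometric linear isomorphism of $L^2(U;\mathbb{R}^q)\otimes L^2(U;\mathbb{R}^q)$ onto $L^2(U\times U;\mathbb{R}^{q\times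 q})$ which, for all $\mathbf{v},\mathbf{w}\in L^2(U;\mathbb{R}^q)$, sends $\mathbf{v}\otimes \mathbf{w}$ to the function $(\mathbf{x},\mathbf{y})\mapsto \mathbf{v}(\mathbf{x})\,\mathbf{w}(\mathbf{y})^{T}$ (almost everywhere). In particular, for every complete orthonormal basis $\{\mathbf{v}_k\}_{k}$ of $L^2(U;\mathbb{R}^q)$ it sends $\mathbf{v}_k\otimes \mathbf{v}_l$ to $\mathbf{v}_k(\mathbf{x})\mathbf{v}_l(\mathbf{y})^{T}$ for all $k,l$. -/

import Mathlib

open MeasureTheory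
open scoped TensorProduct Matrix Matrix.Norms.Frobenius

/-- The Frobenius inner product `(A, B) = 1ᵀ (A ⊙ B) 1 = ∑ i j, A i j * B i j` on real `q × q`
matrices; its norm is the Frobenius norm. The inner product that Mathlib puts on an `L²` space of
matrix-valued functions is then `∫ 1ᵀ (A ⊙ B) 1`. -/
noncomputable instance frobeniusInnerProductSpace (q : ℕ) :
    InnerProductSpace ℝ (Matrix (Fin q) (Fin q) ℝ) where
  inner A B := (1 : Fin q → ℝ) ⬝ᵥ ((A ⊙ B) *ᵥ (1 : Fin q → ℝ))
  norm_sq_eq_re_inner A := by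
    rw [Matrix.frobenius_norm_def, ← Real.sqrt_eq_rpow, Real.sq_sqrt (by positivity)]
    simp [dotProduct, Matrix.mulVec, pow_two]
  conj_inner_symm A B := by
    simp [dotProduct, Matrix.mulVec, mul_comm]
  add_left A B C := by
    simp [dotProduct, Matrix.mulVec, add_mul, Finset.sum_add_distrib]
  smul_left A B r := by
    simp [dotProduct, Matrix.mulVec, mul_assoc, Finset.mul_sum]

/-- `L²(U; ℝ^q)` for `U ⊆ ℝ^d`, with Lebesgue measure on `U`. -/
abbrev L2Vec {d : ℕ} (U : Set (EuclideanSpace ℝ (Fin d))) (q : ℕ) : Type :=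
  Lp (EuclideanSpace ℝ (Fin q)) 2 (volume.restrict U)

/-- `L²(U × U; ℝ^{q × q})` for `U ⊆ ℝ^d`, with Lebesgue measure on `U × U` and the Frobenius
inner product on matrices. -/
abbrev L2Mat {d : ℕ} (U : Set (EuclideanSpace ℝ (Fin d))) (q : ℕ) : Type :=
  Lp (Matrix (Fin q) (Fin q) ℝ) 2 (volume.restrict (U ×ˢ U))

/-- The Hilbert tensor product of two real inner product spaces: the completion of the algebraic
tensor product for the inner product `⟪a ⊗ b, c ⊗ d⟫ = ⟪a, c⟫ * ⟪b, d⟫`. -/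
abbrev HilbertTensor (H K : Type*) [NormedAddCommGroup H] [InnerProductSpace ℝ H]
    [NormedAddCommGroup K] [InnerProductSpace ℝ K] : Type _ :=
  UniformSpace.Completion (H ⊗[ℝ] K)

/-- The elementary tensor `v ⊗ w` as an element of the Hilbert tensor product. -/
noncomputable def hilbertTmul {H K : Type*} [NormedAddCommGroup H] [InnerProductSpace ℝ H]
    [NormedAddCommGroup K] [InnerProductSpace ℝ K] (v : H) (w : K) : HilbertTensor H K :=
  ((v ⊗ₜ[ℝ] w : H ⊗[ℝ] K) : UniformSpace.Completion (H ⊗[ℝ] K))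

section Matrix

variable {q : ℕ}

/-! Pointwise, the Frobenius product of `a bᵀ` and `c dᵀ` is `⟪a, c⟫ * ⟪b, d⟫`, so Fubini makes `v ⊗
w ↦ v(x) w(y)ᵀ` preserve inner products (`inner_vecMulVecₗ`) and hence an isometry of the algebraic
tensor product. Its range is dense: if `F` is orthogonal to it, testing against indicators of
finite-measure rectangles shows that the integral of `F` over each is orthogonal to every rank one
matrix, hence zero, and a π-λ argument gives `F = 0` (`eq_zero_of_forall_inner_vecMulVecₗ`). A dense
isometry into a complete space extends to the completion. -/

theorem inner_vecMulVec_vecMulVec (a b c d : EuclideanSpace ℝ (Fin q)) :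
    inner ℝ (Matrix.vecMulVec a b) (Matrix.vecMulVec c d) = inner ℝ a c * inner ℝ b d := by
  change (1 : Fin q → ℝ) ⬝ᵥ ((Matrix.vecMulVec a b ⊙ Matrix.vecMulVec c d) *ᵥ (1 : Fin q → ℝ)) = _
  simp only [dotProduct, Matrix.mulVec, Matrix.hadamard_apply, Matrix.vecMulVec_apply,
    Pi.one_apply, one_mul, mul_one, PiLp.inner_apply, Finset.sum_mul_sum]
  refine Finset.sum_congr rfl fun i _ => Finset.sum_congr rfl fun j _ => ?_
  simp only [RCLike.inner_apply, conj_trivial]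
  ring

theorem norm_vecMulVec (a b : EuclideanSpace ℝ (Fin q)) :
    ‖Matrix.vecMulVec a b‖ = ‖a‖ * ‖b‖ := by
  rw [← sq_eq_sq₀ (norm_nonneg _) (by positivity), mul_pow, ← real_inner_self_eq_norm_sq,
    inner_vecMulVec_vecMulVec, real_inner_self_eq_norm_sq, real_inner_self_eq_norm_sq]

theorem continuous_vecMulVec :
    Continuous fun p : EuclideanSpace ℝ (Fin q) × EuclideanSpace ℝ (Fin q) =>
      Matrix.vecMulVec p.1 p.2 :=
  continuous_matrix fun i j => by
    simp only [Matrix.vecMulVec_apply]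
    fun_prop

/-- A matrix orthogonal to all rank one matrices vanishes. -/
theorem eq_zero_of_forall_inner_vecMulVec {A : Matrix (Fin q) (Fin q) ℝ}
    (h : ∀ a b : EuclideanSpace ℝ (Fin q), inner ℝ (Matrix.vecMulVec a b) A = 0) : A = 0 := by
  ext i j
  -- For basis vectors the rank one matrix is a matrix unit, which picks out the entry `A i j`.
  have hij := h (EuclideanSpace.single i 1) (EuclideanSpace.single j 1)
  change (1 : Fin q → ℝ) ⬝ᵥ ((Matrix.vecMulVec (EuclideanSpace.single i (1 : ℝ))
    (EuclideanSpace.single j (1 : ℝ)) ⊙ A) *ᵥ (1 : Fin q → ℝ)) = 0 at hij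
  simpa [dotProduct, Matrix.mulVec, Matrix.vecMulVec_apply, Pi.single_apply] using hij

end Matrix

section Rectangles

variable {α β E : Type*} [MeasurableSpace α] [MeasurableSpace β]
  [NormedAddCommGroup E] [NormedSpace ℝ E] [CompleteSpace E]

/-- An integrable function on a product space whose integrals over all measurable rectangles vanish
is zero almost everywhere. -/
theorem MeasureTheory.Integrable.ae_eq_zero_of_forall_setIntegral_prod_eq_zero
    {ρ : Measure (α × β)} {f : α × β → E} (hf : Integrable f ρ)
    (h : ∀ s : Set α, MeasurableSet s → ∀ t : Set β, MeasurableSet t →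
      ∫ p in s ×ˢ t, f p ∂ρ = 0) : f =ᵐ[ρ] 0 := by
  refine hf.ae_eq_zero_of_forall_setIntegral_eq_zero fun s hs hfin => ?_
  -- Finite measure does not pass to complements, so it is dropped before the π-λ induction.
  clear hfin
  induction s, hs using MeasurableSpace.induction_on_inter generateFrom_prod.symm
    isPiSystem_prod with
  | empty => simp
  | basic r hr =>
    obtain ⟨s, hs, t, ht, rfl⟩ := hr
    exact h s hs t ht
  | compl t ht iht =>
    -- The whole space is itself a rectangle.
    have huniv : ∫ p, f p ∂ρ = 0 := by
      simpa using h Set.univ .univ Set.univ .univ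
    rw [setIntegral_compl ht hf, huniv, iht, sub_zero]
  | iUnion g hd hg ih =>
    rw [integral_iUnion hg hd hf.integrableOn]
    simp [ih]

/-- A function on a product of σ-finite spaces whose integrals over all measurable rectangles with
sides of finite measure exist and vanish is zero almost everywhere. -/
theorem MeasureTheory.ae_eq_zero_of_forall_setIntegral_prod_eq_zero
    {μ : Measure α} {ν : Measure β} [SigmaFinite μ] [SigmaFinite ν] {f : α × β → E}
    (hf : ∀ s : Set α, MeasurableSet s → μ s < ⊤ → ∀ t : Set β, MeasurableSet t → ν t < ⊤ →
      IntegrableOn f (s ×ˢ t) (μ.prod ν))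
    (h : ∀ s : Set α, MeasurableSet s → μ s < ⊤ → ∀ t : Set β, MeasurableSet t → ν t < ⊤ →
      ∫ p in s ×ˢ t, f p ∂(μ.prod ν) = 0) : f =ᵐ[μ.prod ν] 0 := by
  have hunion : (⋃ n, spanningSets μ n ×ˢ spanningSets ν n) = Set.univ := by
    rw [Set.iUnion_prod_of_monotone (monotone_spanningSets μ) (monotone_spanningSets ν),
      iUnion_spanningSets, iUnion_spanningSets, Set.univ_prod_univ]
  -- Countably many finite-measure rectangles cover the product; `f` is integrable on each.
  rw [← Measure.restrict_univ (μ := μ.prod ν), ← hunion, Filter.EventuallyEq,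
    ae_restrict_iUnion_iff]
  intro n
  have hs := measurableSet_spanningSets μ n
  have ht := measurableSet_spanningSets ν n
  have hμ := measure_spanningSets_lt_top μ n
  have hν := measure_spanningSets_lt_top ν n
  refine (hf _ hs hμ _ ht hν).ae_eq_zero_of_forall_setIntegral_prod_eq_zero fun s' hs' t' ht' => ?_
  rw [Measure.restrict_restrict (hs'.prod ht'), Set.prod_inter_prod]
  exact h _ (hs'.inter hs) ((measure_mono Set.inter_subset_right).trans_lt hμ)
    _ (ht'.inter ht) ((measure_mono Set.inter_subset_right).trans_lt hν)

end Rectangles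

/-- A linear isometry with dense range into a complete space extends to an isometric isomorphism
from the completion. -/
theorem LinearIsometry.exists_completion_linearIsometryEquiv {E F : Type*} [NormedAddCommGroup E]
    [NormedSpace ℝ E] [NormedAddCommGroup F] [NormedSpace ℝ F] [CompleteSpace F] (f : E →ₗᵢ[ℝ] F)
    (hf : DenseRange f) :
    ∃ Φ : UniformSpace.Completion E ≃ₗᵢ[ℝ] F, ∀ x : E, Φ x = f x :=
  ⟨(LinearEquiv.refl ℝ E).extendOfIsometry
    (UniformSpace.Completion.toComplₗᵢ (𝕜 := ℝ)).toLinearMap f.toLinearMap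
    UniformSpace.Completion.denseRange_coe hf (by simp), fun x =>
    LinearEquiv.extendOfIsometry_eq (LinearEquiv.refl ℝ E)
      (UniformSpace.Completion.toComplₗᵢ (𝕜 := ℝ)).toLinearMap f.toLinearMap
      UniformSpace.Completion.denseRange_coe hf (by simp) x⟩

namespace MeasureTheory.L2

variable {α β : Type*} [MeasurableSpace α] [MeasurableSpace β] {μ : Measure α} {ν : Measure β}
  {q : ℕ}

theorem memLp_vecMulVec (v : Lp (EuclideanSpace ℝ (Fin q)) 2 μ)
    (w : Lp (EuclideanSpace ℝ (Fin q)) 2 ν) :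
    MemLp (fun p : α × β => Matrix.vecMulVec (v p.1) (w p.2)) 2 (μ.prod ν) := by
  have hmeas : AEStronglyMeasurable
      (fun p : α × β => Matrix.vecMulVec (v p.1) (w p.2)) (μ.prod ν) :=
    continuous_vecMulVec.comp_aestronglyMeasurable
      ((Lp.aestronglyMeasurable v).comp_fst.prodMk (Lp.aestronglyMeasurable w).comp_snd)
  refine (memLp_two_iff_integrable_sq_norm hmeas).2 ?_
  simp_rw [norm_vecMulVec, mul_pow]
  exact ((memLp_two_iff_integrable_sq_norm (Lp.aestronglyMeasurable v)).1 (Lp.memLp v)).mul_prod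
    ((memLp_two_iff_integrable_sq_norm (Lp.aestronglyMeasurable w)).1 (Lp.memLp w))

/-- The `L²` function `(x, y) ↦ v x (w y)ᵀ`. -/
noncomputable def vecMulVecLp (v : Lp (EuclideanSpace ℝ (Fin q)) 2 μ)
    (w : Lp (EuclideanSpace ℝ (Fin q)) 2 ν) : Lp (Matrix (Fin q) (Fin q) ℝ) 2 (μ.prod ν) :=
  MemLp.toLp _ (memLp_vecMulVec v w)

theorem coeFn_vecMulVecLp (v : Lp (EuclideanSpace ℝ (Fin q)) 2 μ)
    (w : Lp (EuclideanSpace ℝ (Fin q)) 2 ν) :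
    vecMulVecLp v w =ᵐ[μ.prod ν] fun p => Matrix.vecMulVec (v p.1) (w p.2) :=
  MemLp.coeFn_toLp (memLp_vecMulVec v w)

variable (μ ν q) in
/-- The bilinear map sending `v, w` to the matrix-valued function `(x, y) ↦ v x (w y)ᵀ`. -/
noncomputable def vecMulVecₗ : Lp (EuclideanSpace ℝ (Fin q)) 2 μ →ₗ[ℝ]
    Lp (EuclideanSpace ℝ (Fin q)) 2 ν →ₗ[ℝ] Lp (Matrix (Fin q) (Fin q) ℝ) 2 (μ.prod ν) :=
  LinearMap.mk₂ ℝ vecMulVecLp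
    (fun v v' w => by
      apply Lp.ext
      filter_upwards [coeFn_vecMulVecLp (v + v') w, coeFn_vecMulVecLp v w, coeFn_vecMulVecLp v' w,
        Lp.coeFn_add (vecMulVecLp v w) (vecMulVecLp v' w),
        Measure.quasiMeasurePreserving_fst.ae (Lp.coeFn_add v v')] with p h h₁ h₂ h₃ h₄
      rw [h, h₃, Pi.add_apply, h₁, h₂, h₄]
      exact Matrix.add_vecMulVec _ _ _)
    (fun c v w => by
      apply Lp.ext
      filter_upwards [coeFn_vecMulVecLp (c • v) w, coeFn_vecMulVecLp v w,
        Lp.coeFn_smul c (vecMulVecLp v w),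
        Measure.quasiMeasurePreserving_fst.ae (Lp.coeFn_smul c v)] with p h h₁ h₂ h₃
      rw [h, h₂, Pi.smul_apply, h₁, h₃]
      exact Matrix.smul_vecMulVec _ _ _)
    (fun v w w' => by
      apply Lp.ext
      filter_upwards [coeFn_vecMulVecLp v (w + w'), coeFn_vecMulVecLp v w, coeFn_vecMulVecLp v w',
        Lp.coeFn_add (vecMulVecLp v w) (vecMulVecLp v w'),
        Measure.quasiMeasurePreserving_snd.ae (Lp.coeFn_add w w')] with p h h₁ h₂ h₃ h₄
      rw [h, h₃, Pi.add_apply, h₁, h₂, h₄]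
      exact Matrix.vecMulVec_add _ _ _)
    (fun c v w => by
      apply Lp.ext
      filter_upwards [coeFn_vecMulVecLp v (c • w), coeFn_vecMulVecLp v w,
        Lp.coeFn_smul c (vecMulVecLp v w),
        Measure.quasiMeasurePreserving_snd.ae (Lp.coeFn_smul c w)] with p h h₁ h₂ h₃
      rw [h, h₂, Pi.smul_apply, h₁, h₃]
      exact Matrix.vecMulVec_smul _ _ _)

theorem coeFn_vecMulVecₗ (v : Lp (EuclideanSpace ℝ (Fin q)) 2 μ)
    (w : Lp (EuclideanSpace ℝ (Fin q)) 2 ν) :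
    vecMulVecₗ μ ν q v w =ᵐ[μ.prod ν] fun p => Matrix.vecMulVec (v p.1) (w p.2) :=
  coeFn_vecMulVecLp v w

theorem inner_vecMulVecₗ [SFinite μ] [SFinite ν]
    (v v' : Lp (EuclideanSpace ℝ (Fin q)) 2 μ)
    (w w' : Lp (EuclideanSpace ℝ (Fin q)) 2 ν) :
    inner ℝ (vecMulVecₗ μ ν q v w) (vecMulVecₗ μ ν q v' w') = inner ℝ v v' * inner ℝ w w' := by
  rw [L2.inner_def, L2.inner_def, L2.inner_def, ← integral_prod_mul]
  refine integral_congr_ae ?_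
  filter_upwards [coeFn_vecMulVecₗ v w, coeFn_vecMulVecₗ v' w'] with p hp hp'
  rw [hp, hp', inner_vecMulVec_vecMulVec]

/-- Places the rectangle test functions in the range of the bilinear map. -/
theorem vecMulVecₗ_indicatorConstLp {s : Set α} (hs : MeasurableSet s) (hμs : μ s ≠ ⊤) {t : Set β}
    (ht : MeasurableSet t) (hνt : ν t ≠ ⊤) (hst : (μ.prod ν) (s ×ˢ t) ≠ ⊤)
    (a b : EuclideanSpace ℝ (Fin q)) :
    vecMulVecₗ μ ν q (indicatorConstLp 2 hs hμs a) (indicatorConstLp 2 ht hνt b) =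
      indicatorConstLp 2 (hs.prod ht) hst (Matrix.vecMulVec a b) := by
  apply Lp.ext
  filter_upwards [coeFn_vecMulVecₗ (indicatorConstLp 2 hs hμs a) (indicatorConstLp 2 ht hνt b),
    Measure.quasiMeasurePreserving_fst.ae (indicatorConstLp_coeFn (p := 2) (hs := hs) (hμs := hμs)
      (c := a)),
    Measure.quasiMeasurePreserving_snd.ae (indicatorConstLp_coeFn (p := 2) (hs := ht) (hμs := hνt)
      (c := b)),
    indicatorConstLp_coeFn (μ := μ.prod ν) (p := 2) (hs := hs.prod ht)
      (hμs := hst) (c := Matrix.vecMulVec a b)] with p h h₁ h₂ h₃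
  rw [h, h₁, h₂, h₃]
  by_cases hp₁ : p.1 ∈ s <;> by_cases hp₂ : p.2 ∈ t <;> simp [Set.indicator, hp₁, hp₂]

theorem eq_zero_of_forall_inner_vecMulVecₗ [SigmaFinite μ] [SigmaFinite ν]
    {F : Lp (Matrix (Fin q) (Fin q) ℝ) 2 (μ.prod ν)}
    (h : ∀ v w, inner ℝ (vecMulVecₗ μ ν q v w) F = 0) : F = 0 := by
  rw [Lp.eq_zero_iff_ae_eq_zero]
  have hfin : ∀ s : Set α, μ s < ⊤ → ∀ t : Set β, ν t < ⊤ → (μ.prod ν) (s ×ˢ t) ≠ ⊤ :=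
    fun s hs t ht => by
      rw [Measure.prod_prod]
      exact (ENNReal.mul_lt_top hs ht).ne
  refine ae_eq_zero_of_forall_setIntegral_prod_eq_zero (fun s _ hμs t _ hνt =>
    integrableOn_Lp_of_measure_ne_top F (by norm_num) (hfin s hμs t hνt)) ?_
  intro s hs hμs t ht hνt
  refine eq_zero_of_forall_inner_vecMulVec fun a b => ?_
  -- Pairing a constant matrix with the integral of `F` over `s ×ˢ t` is pairing its indicator
  -- function with `F`.
  rw [← inner_indicatorConstLp_eq_inner_setIntegral ℝ (hs.prod ht) (hfin s hμs t hνt),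
    ← vecMulVecₗ_indicatorConstLp hs hμs.ne ht hνt.ne (hfin s hμs t hνt)]
  exact h _ _

variable (μ ν q) in
/-- The isometric embedding of the algebraic tensor product of two `L²` spaces of vector fields into
the `L²` space of matrix-valued functions on the product. -/
noncomputable def tensorIsometry [SFinite μ] [SFinite ν] :
    (Lp (EuclideanSpace ℝ (Fin q)) 2 μ ⊗[ℝ] Lp (EuclideanSpace ℝ (Fin q)) 2 ν) →ₗᵢ[ℝ]
      Lp (Matrix (Fin q) (Fin q) ℝ) 2 (μ.prod ν) :=
  (TensorProduct.lift (vecMulVecₗ μ ν q)).isometryOfInner fun x y => by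
    induction x with
    | zero => simp
    | add x₁ x₂ h₁ h₂ => simp only [map_add, inner_add_left, h₁, h₂]
    | tmul v w =>
      induction y with
      | zero => simp
      | add y₁ y₂ h₁ h₂ => simp only [map_add, inner_add_right, h₁, h₂]
      | tmul v' w' =>
        rw [TensorProduct.lift.tmul, TensorProduct.lift.tmul, inner_vecMulVecₗ,
          TensorProduct.inner_tmul]

theorem tensorIsometry_tmul [SFinite μ] [SFinite ν]
    (v : Lp (EuclideanSpace ℝ (Fin q)) 2 μ)
    (w : Lp (EuclideanSpace ℝ (Fin q)) 2 ν) :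
    tensorIsometry μ ν q (v ⊗ₜ[ℝ] w) = vecMulVecₗ μ ν q v w :=
  TensorProduct.lift.tmul v w

theorem denseRange_tensorIsometry [SigmaFinite μ] [SigmaFinite ν] :
    DenseRange (tensorIsometry μ ν q) := by
  have htop : (LinearMap.range (tensorIsometry μ ν q).toLinearMap).topologicalClosure = ⊤ := by
    -- In a Hilbert space, density amounts to a trivial orthogonal complement.
    rw [Submodule.topologicalClosure_eq_top_iff, Submodule.eq_bot_iff]
    intro F hF
    refine eq_zero_of_forall_inner_vecMulVecₗ fun v w => ?_
    rw [← tensorIsometry_tmul]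
    exact (Submodule.mem_orthogonal _ _).1 hF _ ⟨_, rfl⟩
  exact Submodule.dense_iff_topologicalClosure_eq_top.2 htop

theorem exists_hilbertTensor_linearIsometryEquiv (μ : Measure α) (ν : Measure β) [SigmaFinite μ]
    [SigmaFinite ν] (q : ℕ) :
    ∃ Φ : HilbertTensor (Lp (EuclideanSpace ℝ (Fin q)) 2 μ) (Lp (EuclideanSpace ℝ (Fin q)) 2 ν)
        ≃ₗᵢ[ℝ] Lp (Matrix (Fin q) (Fin q) ℝ) 2 (μ.prod ν),
      ∀ v w, Φ (hilbertTmul v w) =ᵐ[μ.prod ν] fun p => Matrix.vecMulVec (v p.1) (w p.2) := by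
  obtain ⟨Φ, hΦ⟩ := (tensorIsometry μ ν q).exists_completion_linearIsometryEquiv
    denseRange_tensorIsometry
  refine ⟨Φ, fun v w => ?_⟩
  rw [hilbertTmul, hΦ, tensorIsometry_tmul]
  exact coeFn_vecMulVecₗ v w

end MeasureTheory.L2

theorem proposition2 (d q : ℕ) (U : Set (EuclideanSpace ℝ (Fin d))) (hU : MeasurableSet U) :
    ∃ Φ : HilbertTensor (L2Vec U q) (L2Vec U q) ≃ₗᵢ[ℝ] L2Mat U q,
      ∀ v w : L2Vec U q,
        ∀ᵐ p : EuclideanSpace ℝ (Fin d) × EuclideanSpace ℝ (Fin d)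
            ∂(volume.restrict (U ×ˢ U)),
          (Φ (hilbertTmul v w)) p = Matrix.vecMulVec (v p.1) (w p.2) := by
  have hprod : (volume.restrict (U ×ˢ U) :
      Measure (EuclideanSpace ℝ (Fin d) × EuclideanSpace ℝ (Fin d))) =
      (volume.restrict U).prod (volume.restrict U) :=
    (Measure.prod_restrict U U).symm
  unfold L2Mat
  rw [hprod]
  exact L2.exists_hilbertTensor_linearIsometryEquiv _ _ q
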